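/- Let $n,k\ge 1$. Consider a one-way street with $n$ parking spots numbered $1,\dots,n$ and $n$ cars $c_1,\dots,c_n$ arriving in this order, car $c_i$ having preferred spot $a_i\in\{1,\dots,n\}$. Fix an integer $\ell\ge 0$. Under the $\ell$-Naples rule, each car first checks its preferred spot and then up to $\ell$ spots preceding it, one at a time in decreasing order, and parks in the first free one; if all of these are occupied, it moves forward and parks in the first free spot after its preferred spot, if there is one. The preference $(a_1,\dots,a_n)$ is an $\ell$-Naples parking function of length $n$ if all cars can park under this rule. It is strictly $k$-Naples if it is a $k$-Naples but not a $(k-1)$-Naples parking function, and it is descending if $a_1\ge a_2\ge\cdots\ge a_n$. Then the number of descending strictly $k$-Naples parking functions of length $n$ is $$\frac{k+1}{n}\binom{2n}{n+k+1}.$$ Moreover, if $n\ge k+1$, this number equals the $(n-k-1)$-th term of the $(2k+2)$-fold convolution of the Catalan numbers $C_i=\frac{1}{i+1}\binom{2i}{i}$, that is, $$\sum_{\substack{i_1,\dots,i_{2k+2}\ge 0\\ i_1+\cdots+i_{2k+2}=n-k-1}} C_{i_1}C_{i_2}\cdots C_{i_{2k+2}}.$$ -/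

import Mathlib

/-- The spot in which a car with preference `p` parks, under the `k`-Naples rule, on a one-way
street whose spots are `Fin n` (in this order) and whose set of occupied spots is `occ`.
The car checks its preferred spot `p` and then up to `k` spots before it, in decreasing order, and
takes the first free one, that is, the largest free spot `s` with `p - k ≤ s ≤ p`. If there is none,
it moves forward and takes the first free spot after `p`. The value is `none` if the car cannot
park. -/
def naplesSpot {n : ℕ} (k : ℕ) (occ : Finset (Fin n)) (p : Fin n) : Option (Fin n) :=
  let back : Finset (Fin n) :=
    Finset.univ.filter fun s => s ∉ occ ∧ s ≤ p ∧ (p : ℕ) ≤ (s : ℕ) + k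
  let front : Finset (Fin n) := Finset.univ.filter fun s => s ∉ occ ∧ p < s
  if hb : back.Nonempty then some (back.max' hb)
  else if hf : front.Nonempty then some (front.min' hf)
  else none

/-- A parking preference `a` of length `n` (car `i` prefers the spot `a i`; cars arrive in the order
of `Fin n`) is a `k`-Naples parking function if all cars can park: there is an outcome `d` in
which each car `i` parks in spot `d i` when the spots occupied are those of the cars before it. -/
def IsNaplesParking {n : ℕ} (k : ℕ) (a : Fin n → Fin n) : Prop :=
  ∃ d : Fin n → Fin n, ∀ i : Fin n,
    naplesSpot k ((Finset.univ.filter fun j => j < i).image d) (a i) = some (d i)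

/-- Strictly `k`-Naples, for `k ≥ 1`: `k`-Naples but not `(k - 1)`-Naples. -/
def IsStrictlyNaplesParking {n : ℕ} (k : ℕ) (a : Fin n → Fin n) : Prop :=
  IsNaplesParking k a ∧ ¬ IsNaplesParking (k - 1) a

/-- The number of descending (weakly decreasing) strictly `k`-Naples parking functions of
length `n`. -/
noncomputable def numDescendingStrictlyNaples (n k : ℕ) : ℕ :=
  Nat.card {a : Fin n → Fin n // Antitone a ∧ IsStrictlyNaplesParking k a}

/-- The `m`-th term of the `r`-fold convolution of the Catalan numbers: the sum of
`C (i₁) * ⋯ * C (iᵣ)` over all `r`-tuples of natural numbers with sum `m`. -/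
def catalanConvolution (r m : ℕ) : ℕ :=
  ∑ i ∈ Finset.Nat.antidiagonalTuple r m, ∏ j : Fin r, catalan (i j)

/-!
A weakly decreasing preference `a` is `k`-Naples exactly when `a i + i + 1 ≤ n + k` for every
car `i` (cars and spots are counted from `0`). Indeed, if car `i` cannot park, then all spots from
`a i - k` on are taken by the `i` earlier cars, which gives `n - (a i - k) ≤ i`. Conversely, when all
cars park, the cars `0, …, i` all prefer spots at least `a i`, so they park in distinct spots among
the last `n - (a i - k)` ones.

Decreasing sequences with such a linear upper bound correspond to lattice paths below a line. They
satisfy Pascal's recursion, with a vanishing boundary condition, so the `k`-Naples ones number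
`(2n-1).choose n - (2n-1).choose (n+k+1)` (`ncard_boundedAntitone_add_choose`), and the strictly
`k`-Naples ones number `(2n-1).choose (n+k) - (2n-1).choose (n+k+1)`. The two claims are rewritings
of this difference: the first is elementary, and the second holds because the Catalan series `C`
satisfies `C = 1 + X C²`, whence the coefficients of its powers obey a recursion that determines
them as differences of consecutive binomial coefficients (`catalanConvolution_succ_add_choose`).
-/

/-! ### Descending Naples parking functions -/

lemma naplesSpot_eq_some {n k : ℕ} {occ : Finset (Fin n)} {p s : Fin n}
    (h : naplesSpot k occ p = some s) : s ∉ occ ∧ (p : ℕ) ≤ (s : ℕ) + k := by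
  unfold naplesSpot at h
  dsimp only at h
  split_ifs at h with hb hf
  · have hs := Finset.max'_mem _ hb
    rw [Option.some.inj h] at hs
    simp only [Finset.mem_filter, Finset.mem_univ, true_and] at hs
    exact ⟨hs.1, hs.2.2⟩
  · have hs := Finset.min'_mem _ hf
    rw [Option.some.inj h] at hs
    simp only [Finset.mem_filter, Finset.mem_univ, true_and] at hs
    exact ⟨hs.1, by have := Fin.lt_def.1 hs.2; omega⟩

lemma mem_of_naplesSpot_eq_none {n k : ℕ} {occ : Finset (Fin n)} {p : Fin n}
    (h : naplesSpot k occ p = none) {s : Fin n} (hs : (p : ℕ) ≤ (s : ℕ) + k) : s ∈ occ := by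
  unfold naplesSpot at h
  dsimp only at h
  split_ifs at h with hb hf
  by_contra hocc
  rcases le_or_gt s p with hsp | hsp
  · exact hb ⟨s, by simp [hocc, hsp, hs]⟩
  · exact hf ⟨s, by simp [hocc, hsp]⟩

lemma card_filter_le_add {n p k : ℕ} (hk : k ≤ p) :
    (Finset.univ.filter fun s : Fin n => p ≤ (s : ℕ) + k).card = n - (p - k) := by
  have h : (Finset.univ.filter fun s : Fin n => p ≤ (s : ℕ) + k).map Fin.valEmbedding
      = Finset.Ico (p - k) n := by
    ext x
    simp only [Finset.mem_map, Finset.mem_filter, Finset.mem_univ, true_and,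
      Fin.valEmbedding_apply, Finset.mem_Ico]
    constructor
    · rintro ⟨s, hs, rfl⟩
      have := s.2
      omega
    · rintro ⟨h1, h2⟩
      exact ⟨⟨x, h2⟩, by simp only; omega, rfl⟩
  rw [← Finset.card_map, h, Nat.card_Ico]

/-- The sufficient condition holds for every preference, descending or not: a car that cannot park
finds all spots from `a i - k` on taken by the `i` cars before it. -/
lemma isNaplesParking_of_add_le {n k : ℕ} {a : Fin n → Fin n}
    (h : ∀ i : Fin n, (a i : ℕ) + i + 1 ≤ n + k) : IsNaplesParking k a := by
  -- The outcome is built for the first `t` cars at a time.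
  suffices H : ∀ t ≤ n, ∃ d : Fin n → Fin n, ∀ i : Fin n, (i : ℕ) < t →
      naplesSpot k ((Finset.univ.filter fun j => j < i).image d) (a i) = some (d i) by
    obtain ⟨d, hd⟩ := H n le_rfl
    exact ⟨d, fun i => hd i i.2⟩
  intro t
  induction t with
  | zero => exact fun _ => ⟨id, fun i hi => absurd hi (Nat.not_lt_zero _)⟩
  | succ t ih =>
    intro ht
    obtain ⟨d, hd⟩ := ih (by omega)
    let c : Fin n := ⟨t, ht⟩
    obtain ⟨s, hs⟩ : ∃ s,
        naplesSpot k ((Finset.univ.filter fun j => j < c).image d) (a c) = some s := by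
      rw [← Option.ne_none_iff_exists']
      intro hnone
      have hsub : (Finset.univ.filter fun s : Fin n => (a c : ℕ) ≤ (s : ℕ) + k)
          ⊆ (Finset.univ.filter fun j => j < c).image d := by
        intro s hs
        exact mem_of_naplesSpot_eq_none hnone (by simpa using hs)
      have hle := (Finset.card_le_card hsub).trans Finset.card_image_le
      have hc : (Finset.univ.filter fun j : Fin n => j < c).card = t := by
        rw [Finset.filter_gt_eq_Iio, Fin.card_Iio]
      have hac := h c
      have hct : (c : ℕ) = t := rfl
      rcases le_or_gt k (a c : ℕ) with hka | hka
      · rw [card_filter_le_add hka, hc] at hle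
        have := (a c).2
        omega
      · rw [Finset.filter_true_of_mem (fun s _ => by omega), Finset.card_univ,
          Fintype.card_fin, hc] at hle
        omega
    refine ⟨Function.update d c s, fun i hi => ?_⟩
    have himg : (Finset.univ.filter fun j => j < i).image (Function.update d c s)
        = (Finset.univ.filter fun j => j < i).image d := by
      refine Finset.image_congr fun j hj => ?_
      have hj' : j < i := by simpa using hj
      refine Function.update_of_ne (fun hjc => ?_) _ _
      rw [hjc] at hj'
      have h2 : t < (i : ℕ) := hj'
      omega
    rw [himg]
    by_cases hic : i = c
    · rw [hic, Function.update_self, hs]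
    · rw [Function.update_of_ne hic]
      have : (i : ℕ) ≠ t := fun hit => hic (Fin.ext hit)
      exact hd i (by omega)

lemma isNaplesParking_iff_of_antitone {n k : ℕ} {a : Fin n → Fin n} (ha : Antitone a) :
    IsNaplesParking k a ↔ ∀ i : Fin n, (a i : ℕ) + i + 1 ≤ n + k := by
  refine ⟨?_, isNaplesParking_of_add_le⟩
  rintro ⟨d, hd⟩ i
  have hne : ∀ j l : Fin n, j < l → d j ≠ d l := fun j l hjl hdjl =>
    (naplesSpot_eq_some (hd l)).1 (Finset.mem_image.2 ⟨j, by simpa using hjl, hdjl⟩)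
  have hinj : Function.Injective d := fun j l hjl => by
    by_contra hjl'
    rcases lt_or_gt_of_ne hjl' with hlt | hlt
    · exact hne _ _ hlt hjl
    · exact hne _ _ hlt hjl.symm
  rcases le_or_gt k (a i : ℕ) with hka | hka
  · have hsub : (Finset.Iic i).image d
        ⊆ Finset.univ.filter fun s : Fin n => (a i : ℕ) ≤ (s : ℕ) + k := by
      intro s hs
      obtain ⟨j, hj, rfl⟩ := Finset.mem_image.1 hs
      have hji : (a i : ℕ) ≤ a j := ha (Finset.mem_Iic.1 hj)
      simpa using hji.trans (naplesSpot_eq_some (hd j)).2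
    have hle := Finset.card_le_card hsub
    rw [Finset.card_image_of_injective _ hinj, Fin.card_Iic, card_filter_le_add hka] at hle
    have := (a i).2
    omega
  · have := i.2
    omega

/-! ### Counting decreasing sequences below a line -/

/-- The weakly decreasing sequences `a₀ ≥ ⋯ ≥ aₘ₋₁` of natural numbers at most `v` that satisfy
`aᵢ + i + 1 ≤ m + k` for all `i`. This form of the linear bound is the one that is preserved when
the first term is removed. -/
def boundedAntitone (k m v : ℕ) : Set (Fin m → ℕ) :=
  {a | Antitone a ∧ ∀ i : Fin m, a i + i + 1 ≤ m + k ∧ a i ≤ v}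

lemma finite_boundedAntitone (k m v : ℕ) : (boundedAntitone k m v).Finite :=
  (Set.finite_Iic (fun _ : Fin m => v)).subset fun _ ha i => (ha.2 i).2

lemma boundedAntitone_mono_bound (k m : ℕ) {v w : ℕ} (hvw : v ≤ w) :
    boundedAntitone k m v ⊆ boundedAntitone k m w :=
  fun _ ha => ⟨ha.1, fun i => ⟨(ha.2 i).1, (ha.2 i).2.trans hvw⟩⟩

/-- A sequence whose first term is at most `v` is bounded by `v`. -/
lemma mem_boundedAntitone_of_zero_le {k m v w : ℕ} {a : Fin (m + 1) → ℕ}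
    (ha : a ∈ boundedAntitone k (m + 1) w) (h0 : a 0 ≤ v) :
    a ∈ boundedAntitone k (m + 1) v :=
  ⟨ha.1, fun i => ⟨(ha.2 i).1, (ha.1 (Fin.zero_le i)).trans h0⟩⟩

lemma vecCons_mem_boundedAntitone {k m v : ℕ} (hv : v ≤ m + k) (a : Fin m → ℕ) :
    Matrix.vecCons v a ∈ boundedAntitone k (m + 1) v ↔ a ∈ boundedAntitone k m v := by
  constructor
  · rintro ⟨h1, h2⟩
    refine ⟨fun i j hij => ?_, fun i => ?_⟩
    · simpa using h1 (Fin.succ_le_succ_iff.2 hij)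
    · have h := h2 i.succ
      simp only [Matrix.cons_val_succ, Fin.val_succ] at h
      exact ⟨by omega, h.2⟩
  · rintro ⟨h1, h2⟩
    constructor
    · intro i j hij
      induction i using Fin.cases with
      | zero =>
        induction j using Fin.cases with
        | zero => rfl
        | succ j => simpa using (h2 j).2
      | succ i =>
        induction j using Fin.cases with
        | zero => exact absurd hij (by simp)
        | succ j => simpa using h1 (Fin.succ_le_succ_iff.1 hij)
    · intro i
      induction i using Fin.cases with
      | zero => exact ⟨by simp only [Matrix.cons_val_zero, Fin.val_zero]; omega, le_rfl⟩
      | succ i =>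
        have h := h2 i
        simp only [Matrix.cons_val_succ, Fin.val_succ]
        exact ⟨by omega, h.2⟩

/-- The sequences are split by whether the first term equals the bound `v + 1`. -/
lemma ncard_boundedAntitone_succ {k m v : ℕ} (hv : v + 1 ≤ m + k) :
    (boundedAntitone k (m + 1) (v + 1)).ncard
      = (boundedAntitone k (m + 1) v).ncard + (boundedAntitone k m (v + 1)).ncard := by
  have hinj : Function.Injective (Matrix.vecCons (v + 1) : (Fin m → ℕ) → Fin (m + 1) → ℕ) :=
    fun a b hab => (Matrix.vecCons_inj.1 hab).2
  have hunion : boundedAntitone k (m + 1) (v + 1)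
      = boundedAntitone k (m + 1) v ∪ Matrix.vecCons (v + 1) '' boundedAntitone k m (v + 1) := by
    ext a
    constructor
    · intro ha
      rcases le_or_gt (a 0) v with h0 | h0
      · exact Or.inl (mem_boundedAntitone_of_zero_le ha h0)
      · have h0' : v + 1 = a 0 := le_antisymm h0 (ha.2 0).2
        have hcons : Matrix.vecCons (v + 1) (Matrix.vecTail a) = a := by
          rw [h0']
          exact Matrix.cons_head_tail a
        exact Or.inr ⟨Matrix.vecTail a,
          (vecCons_mem_boundedAntitone hv _).1 (hcons.symm ▸ ha), hcons⟩
    · rintro (ha | ⟨b, hb, rfl⟩)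
      · exact boundedAntitone_mono_bound _ _ (Nat.le_succ v) ha
      · exact (vecCons_mem_boundedAntitone hv b).2 hb
  have hdisj : Disjoint (boundedAntitone k (m + 1) v)
      (Matrix.vecCons (v + 1) '' boundedAntitone k m (v + 1)) := by
    rw [Set.disjoint_left]
    rintro _ ha ⟨b, -, rfl⟩
    exact absurd (ha.2 0).2 (by simp)
  rw [hunion, Set.ncard_union_eq hdisj (finite_boundedAntitone ..)
    ((finite_boundedAntitone ..).image _), Set.ncard_image_of_injective _ hinj]

lemma ncard_boundedAntitone_zero_right (k m : ℕ) : (boundedAntitone k m 0).ncard = 1 := by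
  refine Set.ncard_eq_one.2 ⟨fun _ => 0, ?_⟩
  ext a
  simp only [Set.mem_singleton_iff]
  constructor
  · exact fun ha => funext fun i => Nat.le_zero.1 (ha.2 i).2
  · rintro rfl
    exact ⟨fun _ _ _ => le_rfl, fun i => ⟨by have := i.2; dsimp only; omega, le_rfl⟩⟩

/-- The reflection formula for lattice paths below a line. -/
lemma ncard_boundedAntitone_add_choose (k m v : ℕ) (hv : v ≤ m + k) :
    (boundedAntitone k m v).ncard + (m + v).choose (m + k + 1) = (m + v).choose m := by
  induction m generalizing v with
  | zero =>
    rw [Nat.choose_eq_zero_of_lt (by omega), Nat.choose_zero_right, add_zero]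
    refine Set.ncard_eq_one.2 ⟨![], ?_⟩
    ext a
    simp only [Set.mem_singleton_iff, Subsingleton.elim a ![], iff_true]
    exact ⟨fun i => i.elim0, fun i => i.elim0⟩
  | succ m ihm =>
    induction v with
    | zero =>
      rw [ncard_boundedAntitone_zero_right, Nat.choose_eq_zero_of_lt (by omega), add_zero,
        Nat.choose_self]
    | succ v ihv =>
      have h1 := ihv (by omega)
      have e1 : m + 1 + (v + 1) = m + v + 1 + 1 := by omega
      have e2 : m + 1 + v = m + v + 1 := by omega
      have e3 : m + 1 + k + 1 = m + k + 1 + 1 := by omega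
      rw [e2, e3] at h1
      rw [e1, e3, Nat.choose_succ_succ' (m + v + 1) (m + k + 1),
        Nat.choose_succ_succ' (m + v + 1) m]
      rcases le_or_gt (v + 1) (m + k) with hle | hlt
      · have h2 := ihm (v + 1) hle
        rw [show m + (v + 1) = m + v + 1 by omega] at h2
        rw [ncard_boundedAntitone_succ hle]
        omega
      · -- On the boundary `v = m + k` the first term cannot reach `v + 1`, and the two remaining
        -- binomial coefficients agree by symmetry.
        have hset : boundedAntitone k (m + 1) (v + 1) = boundedAntitone k (m + 1) v := by
          refine Set.Subset.antisymm (fun a ha => mem_boundedAntitone_of_zero_le ha ?_)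
            (boundedAntitone_mono_bound _ _ (Nat.le_succ v))
          have h0 := (ha.2 0).1
          rw [Fin.val_zero] at h0
          omega
        have hsymm : (m + v + 1).choose (m + k + 1) = (m + v + 1).choose m :=
          Nat.choose_symm_of_eq_add (by omega)
        rw [hset]
        omega

/-! ### Counting strictly Naples descending preferences -/

/-- The strictly `k`-Naples descending preferences form the difference of the two nested sets of
bounded sequences that describe the `k`-Naples and the `(k - 1)`-Naples ones. -/
lemma numDescendingStrictlyNaples_add_ncard {n k : ℕ} (hn : 1 ≤ n) :
    numDescendingStrictlyNaples n k + (boundedAntitone (k - 1) n (n - 1)).ncard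
      = (boundedAntitone k n (n - 1)).ncard := by
  have hsub : boundedAntitone (k - 1) n (n - 1) ⊆ boundedAntitone k n (n - 1) :=
    fun a ha => ⟨ha.1, fun i => ⟨by have := (ha.2 i).1; omega, (ha.2 i).2⟩⟩
  rw [← Set.ncard_sdiff_add_ncard_of_subset hsub (finite_boundedAntitone ..)]
  congr 1
  have hinj : Function.Injective fun (a : Fin n → Fin n) (i : Fin n) => (a i : ℕ) :=
    fun a b hab => funext fun i => Fin.ext (congrFun hab i)
  have hcard : numDescendingStrictlyNaples n k
      = {a : Fin n → Fin n | Antitone a ∧ IsStrictlyNaplesParking k a}.ncard :=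
    Nat.card_coe_set_eq _
  rw [hcard, ← Set.ncard_image_of_injective _ hinj]
  · congr 1
    ext b
    constructor
    · rintro ⟨a, ⟨ha, hs⟩, rfl⟩
      rw [IsStrictlyNaplesParking, isNaplesParking_iff_of_antitone ha,
        isNaplesParking_iff_of_antitone ha] at hs
      refine ⟨⟨ha, fun i => ⟨hs.1 i, by have := (a i).2; simp only; omega⟩⟩, fun hb => ?_⟩
      exact hs.2 fun i => (hb.2 i).1
    · rintro ⟨hb, hb'⟩
      have hlt : ∀ i, b i < n := fun i => by have := (hb.2 i).2; omega
      have ha : Antitone fun i => (⟨b i, hlt i⟩ : Fin n) := hb.1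
      refine ⟨fun i => ⟨b i, hlt i⟩, ⟨ha, ?_⟩, rfl⟩
      rw [IsStrictlyNaplesParking, isNaplesParking_iff_of_antitone ha,
        isNaplesParking_iff_of_antitone ha]
      exact ⟨fun i => (hb.2 i).1, fun h => hb' ⟨hb.1, fun i => ⟨h i, (hb.2 i).2⟩⟩⟩

lemma numDescendingStrictlyNaples_add_choose {n k : ℕ} (hn : 1 ≤ n) (hk : 1 ≤ k) :
    numDescendingStrictlyNaples n k + (2 * n - 1).choose (n + k + 1)
      = (2 * n - 1).choose (n + k) := by
  have h := numDescendingStrictlyNaples_add_ncard (k := k) hn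
  have h1 := ncard_boundedAntitone_add_choose k n (n - 1) (by omega)
  have h2 := ncard_boundedAntitone_add_choose (k - 1) n (n - 1) (by omega)
  rw [show n + (n - 1) = 2 * n - 1 by omega] at h1 h2
  rw [show n + (k - 1) + 1 = n + k by omega] at h2
  omega

/-! ### Convolutions of the Catalan numbers -/

open PowerSeries in
lemma catalanConvolution_eq_coeff (r m : ℕ) :
    catalanConvolution r m = coeff m (catalanSeries ^ r) := by
  have h : catalanSeries ^ r = ∏ _j : Fin r, catalanSeries := by simp
  rw [h, coeff_prod, catalanConvolution]
  refine Finset.sum_nbij' (fun i => Finsupp.equivFunOnFinite.symm i) (fun f => ⇑f) ?_ ?_ ?_ ?_ ?_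
  · intro i hi
    simpa [Finset.mem_finsuppAntidiag, Finset.Nat.mem_antidiagonalTuple] using hi
  · intro f hf
    simpa [Finset.mem_finsuppAntidiag, Finset.Nat.mem_antidiagonalTuple] using hf
  · intro i _
    rfl
  · intro f _
    ext
    rfl
  · intro i _
    simp

lemma catalanConvolution_zero_right (r : ℕ) : catalanConvolution r 0 = 1 := by
  simp [catalanConvolution, Finset.Nat.antidiagonalTuple_zero_right]

/-- The coefficientwise form of `C ^ (r + 1) = C ^ r + X * C ^ (r + 2)`. -/
lemma catalanConvolution_succ_succ (r m : ℕ) :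
    catalanConvolution (r + 1) (m + 1)
      = catalanConvolution r (m + 1) + catalanConvolution (r + 2) m := by
  simp only [catalanConvolution_eq_coeff]
  have h : PowerSeries.catalanSeries ^ (r + 1) = PowerSeries.catalanSeries ^ r
      + PowerSeries.catalanSeries ^ (r + 2) * PowerSeries.X := by
    calc PowerSeries.catalanSeries ^ (r + 1)
        = PowerSeries.catalanSeries ^ r * PowerSeries.catalanSeries := pow_succ _ _
      _ = PowerSeries.catalanSeries ^ r
          * (PowerSeries.catalanSeries ^ 2 * PowerSeries.X + 1) := by
        rw [PowerSeries.catalanSeries_sq_mul_X_add_one]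
      _ = _ := by ring
  rw [h, map_add, PowerSeries.coeff_succ_mul_X]

lemma catalanConvolution_succ_add_choose (r m : ℕ) :
    catalanConvolution r (m + 1) + (2 * m + r + 1).choose m
      = (2 * m + r + 1).choose (m + 1) := by
  induction m generalizing r with
  | zero =>
    induction r with
    | zero => simp [catalanConvolution]
    | succ r ih =>
      rw [catalanConvolution_succ_succ, catalanConvolution_zero_right]
      simp only [Nat.choose_zero_right, zero_add, Nat.choose_one_right] at ih ⊢
      omega
  | succ m ihm =>
    induction r with
    | zero =>
      have h0 : catalanConvolution 0 (m + 1 + 1) = 0 := by simp [catalanConvolution]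
      rw [h0, zero_add]
      exact Nat.choose_symm_of_eq_add (by omega)
    | succ r ih =>
      have h2 := ihm (r + 2)
      rw [show 2 * m + (r + 2) + 1 = 2 * (m + 1) + r + 1 by omega] at h2
      rw [catalanConvolution_succ_succ, ← add_assoc (2 * (m + 1)) r 1,
        Nat.choose_succ_succ' (2 * (m + 1) + r + 1) m,
        Nat.choose_succ_succ' (2 * (m + 1) + r + 1) (m + 1)]
      omega

/-! ### The two formulas -/

theorem theorem5p5 (n k : ℕ) (hn : 1 ≤ n) (hk : 1 ≤ k) :
    (numDescendingStrictlyNaples n k : ℚ)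
        = ((k : ℚ) + 1) / (n : ℚ) * (Nat.choose (2 * n) (n + k + 1) : ℚ) ∧
      (k + 1 ≤ n →
        numDescendingStrictlyNaples n k = catalanConvolution (2 * k + 2) (n - k - 1)) := by
  have hN := numDescendingStrictlyNaples_add_choose hn hk
  constructor
  · have hpascal : (2 * n).choose (n + k + 1)
        = (2 * n - 1).choose (n + k) + (2 * n - 1).choose (n + k + 1) := by
      rw [← Nat.choose_succ_succ', show 2 * n - 1 + 1 = 2 * n by omega]
    have hratio : ((2 * n - 1).choose (n + k + 1) : ℚ) * (n + k + 1)
        = (2 * n - 1).choose (n + k) * ((n : ℚ) - k - 1) := by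
      rcases le_or_gt (k + 1) n with hkn | hkn
      · have h := Nat.choose_succ_right_eq (2 * n - 1) (n + k)
        obtain ⟨m, rfl⟩ := Nat.exists_eq_add_of_le hkn
        rw [show 2 * (k + 1 + m) - 1 - (k + 1 + m + k) = m by omega] at h
        have h' := congrArg (Nat.cast : ℕ → ℚ) h
        push_cast at h' ⊢
        linear_combination h'
      · -- Both binomial coefficients vanish.
        rw [Nat.choose_eq_zero_of_lt (by omega), Nat.choose_eq_zero_of_lt (by omega)]
        simp
    have hNq := congrArg (Nat.cast : ℕ → ℚ) hN
    have hn0 : (n : ℚ) ≠ 0 := by positivity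
    rw [hpascal]
    push_cast at hNq ⊢
    field_simp
    linear_combination (n : ℚ) * hNq - hratio
  · intro hkn
    obtain ⟨m, rfl⟩ := Nat.exists_eq_add_of_le hkn
    rw [show k + 1 + m - k - 1 = m by omega]
    rcases m with _ | m
    · rw [catalanConvolution_zero_right]
      rw [Nat.choose_eq_zero_of_lt (by omega),
        show 2 * (k + 1 + 0) - 1 = k + 1 + 0 + k by omega, Nat.choose_self] at hN
      exact hN
    · have h := catalanConvolution_succ_add_choose (2 * k + 2) m
      rw [show 2 * (k + 1 + (m + 1)) - 1 = 2 * m + (2 * k + 2) + 1 by omega,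
        Nat.choose_symm_of_eq_add (show 2 * m + (2 * k + 2) + 1
          = (k + 1 + (m + 1) + k + 1) + m by omega),
        Nat.choose_symm_of_eq_add (show 2 * m + (2 * k + 2) + 1
          = (k + 1 + (m + 1) + k) + (m + 1) by omega)] at hN
      omega
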